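/- Let $\Omega=\{0,1\}^\infty$ and $\Pi=([0,1]\times\{0,1\})^\infty$ carry the product topologies, let $\Omega^\diamond$ and $\Pi^\diamond$ be the corresponding sets of finite sequences (including the empty sequence $\Lambda$), and for $x\in\Omega^\diamond$ let $\Gamma(x)\subseteq\Omega$ be the set of infinite extensions of $x$. A non-negative farthingale is a function $V:\Pi^\diamond\to[0,\infty]$ such that $$V(x)=(1-p)\,V(x,p,0)+p\,V(x,p,1)\qquad\text{for all }x\in\Pi^\diamond,\ p\in[0,1],$$ where $0\cdot\infty=0$. For $\pi=(p_1,y_1,p_2,y_2,\ldots)\in\Pi$ write $\pi^n=(p_1,y_1,\ldots,p_n,y_n)$. The upper game-theoretic probability of $E\subseteq\Pi$ is $$\overline{\mathbb P}^{\mathrm{game}}(E)=\inf\bigl\{V(\Lambda)\ :\ V\text{ a non-negative farthingale with }\limsup_{n}V(\pi^n)\ge 1\text{ for all }\pi\in E\bigr\}.$$ A forecasting system is a function $\phi:\Omega^\diamond\to[0,1]$. Let $\mathbb P_\phi$ be the unique Borel probability measure on $\Omega$ with $\mathbb P_\phi(\Gamma(x1))=\phi(x)\,\mathbb P_\phi(\Gamma(x))$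 for all $x\in\Omega^\diamond$, extended to all subsets of $\Omega$ as an outer measure. For $\omega=(y_1,y_2,\ldots)\in\Omega$ put $\omega^\phi=(\phi(\Lambda),y_1,\phi(y_1),y_2,\phi(y_1,y_2),y_3,\ldots)\in\Pi$, and let $E^\phi=\{\omega\in\Omega:\omega^\phi\in E\}$. The upper measure-theoretic probability of $E\subseteq\Pi$ is $$\overline{\mathbb P}^{\mathrm{meas}}(E)=\sup_{\phi}\mathbb P_\phi(E^\phi),$$ the supremum being over all forecasting systems $\phi$. Theorem. For every analytic set $E\subseteq\Pi$, $\overline{\mathbb P}^{\mathrm{game}}(E)=\overline{\mathbb P}^{\mathrm{meas}}(E)$. -/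

import Mathlib

open MeasureTheory Filter
open scoped ENNReal unitInterval

namespace Prequential

/-- The first `n` terms of an infinite sequence, as a finite sequence. -/
def initSeg {α : Type*} (s : ℕ → α) (n : ℕ) : List α :=
  (List.range n).map s

/-- The set `Γ(x)` of all infinite extensions of the finite sequence `x`. -/
def extensions {α : Type*} (x : List α) : Set (ℕ → α) :=
  {s | initSeg s x.length = x}

/-- The space `Ω` of infinite sequences of outcomes; `true` is the outcome `1` and `false` is the
outcome `0`. The topology is the product topology. -/
abbrev Outcomes : Type := ℕ → Bool

/-- The prequential space `([0,1] × {0,1})^∞` of infinite sequences of forecast/outcome pairs, with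
the product topology. Finite such sequences are elements of `List (I × Bool)`. -/
abbrev PrequentialSpace : Type := ℕ → I × Bool

/-! ### Game-theoretic probability -/

/-- `V` is a non-negative farthingale: a function from the finite sequences of forecast/outcome
pairs to `[0,∞]` with `V(x) = (1 - p) V(x,p,0) + p V(x,p,1)` for every `x` and every forecast `p`
(where `0 * ∞ = 0`). -/
def IsNonnegFarthingale (V : List (I × Bool) → ℝ≥0∞) : Prop :=
  ∀ (x : List (I × Bool)) (p : I),
    V x = ENNReal.ofReal (1 - (p : ℝ)) * V (x ++ [(p, false)]) +
      ENNReal.ofReal (p : ℝ) * V (x ++ [(p, true)])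

/-- The upper game-theoretic probability of a set `E` of forecast/outcome sequences. -/
noncomputable def upperGameProb (E : Set PrequentialSpace) : ℝ≥0∞ :=
  sInf {a | ∃ V : List (I × Bool) → ℝ≥0∞, IsNonnegFarthingale V ∧ V [] = a ∧
    ∀ s ∈ E, 1 ≤ limsup (fun n => V (initSeg s n)) atTop}

/-! ### Measure-theoretic probability -/

/-- A forecasting system gives the forecast that follows each finite sequence of outcomes. -/
abbrev ForecastingSystem : Type := List Bool → I

/-- `P` is a probability measure on the outcome sequences such that, for each finite sequence `x`
of outcomes, `P(Γ(x1)) = φ(x) P(Γ(x))`. -/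
structure IsForecastMeasure (φ : ForecastingSystem) (P : Measure Outcomes) : Prop where
  isProbabilityMeasure : IsProbabilityMeasure P
  measure_extensions_append_true : ∀ x : List Bool,
    P (extensions (x ++ [true])) = ENNReal.ofReal (φ x : ℝ) * P (extensions x)

theorem initSeg_succ {α : Type*} (s : ℕ → α) (n : ℕ) :
    initSeg s (n + 1) = initSeg s n ++ [s n] := by
  simp [initSeg, List.range_succ]

theorem length_initSeg {α : Type*} (s : ℕ → α) (n : ℕ) : (initSeg s n).length = n := by
  simp [initSeg]

theorem initSeg_eq_iff {α : Type*} (s t : ℕ → α) (n : ℕ) :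
    initSeg s n = initSeg t n ↔ ∀ i < n, s i = t i := by
  simp [initSeg]

theorem mem_extensions_append {α : Type*} (s : ℕ → α) (x : List α) (y : α) :
    s ∈ extensions (x ++ [y]) ↔ s ∈ extensions x ∧ s x.length = y := by
  simp only [extensions, Set.mem_ofPred_eq, List.length_append, List.length_singleton, initSeg_succ]
  constructor
  · intro h
    have := List.append_inj h (length_initSeg _ _)
    simpa using this
  · rintro ⟨h, h'⟩
    rw [h, h']

theorem extensions_nil {α : Type*} : extensions ([] : List α) = Set.univ := by
  ext s; simp [extensions, initSeg]

theorem extensions_eq_union (x : List Bool) :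
    extensions x = extensions (x ++ [false]) ∪ extensions (x ++ [true]) := by
  ext s
  simp only [Set.mem_union, mem_extensions_append]
  cases s x.length <;> simp

theorem disjoint_extensions (x : List Bool) :
    Disjoint (extensions (x ++ [false])) (extensions (x ++ [true])) := by
  rw [Set.disjoint_left]
  intro s h h'
  rw [mem_extensions_append] at h h'
  simp_all

theorem measurableSet_extensions (x : List Bool) : MeasurableSet (extensions x) := by
  induction x using List.reverseRecOn with
  | nil => simp [extensions_nil]
  | append_singleton x y ih =>
    have : extensions (x ++ [y]) = extensions x ∩ (fun s : Outcomes => s x.length) ⁻¹' {y} := by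
      ext s; simp [mem_extensions_append]
    rw [this]
    exact ih.inter (measurable_pi_apply _ (measurableSet_singleton y))

theorem generateFrom_extensions :
    (MeasurableSpace.pi : MeasurableSpace Outcomes) =
      MeasurableSpace.generateFrom (Set.range (extensions (α := Bool))) := by
  apply le_antisymm
  · refine iSup_le fun i => ?_
    rw [← measurable_iff_comap_le]
    refine @measurable_to_countable' _ _ _ _ (_) _ fun b => ?_
    have : (fun s : Outcomes => s i) ⁻¹' {b} =
        ⋃ x : {x : List Bool // x.length = i}, extensions (x.1 ++ [b]) := by
      ext s
      simp only [Set.mem_preimage, Set.mem_singleton_iff, Set.mem_iUnion, mem_extensions_append]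
      constructor
      · intro h
        refine ⟨⟨initSeg s i, length_initSeg s i⟩, ?_, ?_⟩
        · simp [extensions, length_initSeg]
        · simpa [length_initSeg] using h
      · rintro ⟨⟨x, rfl⟩, -, h⟩
        exact h
    rw [this]
    exact MeasurableSet.iUnion fun x => MeasurableSpace.measurableSet_generateFrom ⟨_, rfl⟩
  · apply MeasurableSpace.generateFrom_le
    rintro _ ⟨x, rfl⟩
    exact measurableSet_extensions x

theorem extensions_subset {α : Type*} {x z : List α} {s : ℕ → α} (hx : s ∈ extensions x)
    (hz : s ∈ extensions z) (h : x.length ≤ z.length) : extensions z ⊆ extensions x := by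
  intro t ht
  simp only [extensions, Set.mem_ofPred_eq] at *
  have h1 : initSeg t z.length = initSeg s z.length := ht.trans hz.symm
  rw [initSeg_eq_iff] at h1
  rw [← hx, length_initSeg, initSeg_eq_iff]
  exact fun i hi => h1 i (hi.trans_le h)

theorem isPiSystem_extensions : IsPiSystem (Set.range (extensions (α := Bool))) := by
  rintro _ ⟨x, rfl⟩ _ ⟨z, rfl⟩ ⟨s, hx, hz⟩
  rcases le_total x.length z.length with h | h
  · exact ⟨z, (Set.inter_eq_right.2 (extensions_subset hx hz h)).symm⟩
  · exact ⟨x, (Set.inter_eq_left.2 (extensions_subset hz hx h)).symm⟩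

theorem IsForecastMeasure.unique {φ : ForecastingSystem} {P Q : Measure Outcomes}
    (hP : IsForecastMeasure φ P) (hQ : IsForecastMeasure φ Q) : P = Q := by
  have := hP.isProbabilityMeasure
  have := hQ.isProbabilityMeasure
  have key : ∀ x : List Bool, P (extensions x) = Q (extensions x) := by
    intro x
    induction x using List.reverseRecOn with
    | nil => simp [extensions_nil]
    | append_singleton x y ih =>
      have ht : P (extensions (x ++ [true])) = Q (extensions (x ++ [true])) := by
        rw [hP.2, hQ.2, ih]
      cases y with
      | true => exact ht
      | false =>
        have hd := disjoint_extensions x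
        have hm := measurableSet_extensions (x ++ [true])
        rw [extensions_eq_union x, measure_union hd hm, measure_union hd hm, ht] at ih
        exact (ENNReal.add_left_inj (measure_ne_top Q _)).1 ih
  refine ext_of_generate_finite _ generateFrom_extensions isPiSystem_extensions ?_ (by simp)
  rintro _ ⟨x, rfl⟩
  exact key x

/-- The outcomes produced by a sequence `u` of points of `[0,1]`: after outcomes `x`, the `n`-th
outcome is `1` iff `u n < φ x`. -/
noncomputable def simulateList (φ : ForecastingSystem) (u : ℕ → I) : ℕ → List Bool
  | 0 => []
  | n + 1 => simulateList φ u n ++ [decide (u n < φ (simulateList φ u n))]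

noncomputable def simulate (φ : ForecastingSystem) (u : ℕ → I) : Outcomes :=
  fun n => decide (u n < φ (simulateList φ u n))

theorem initSeg_simulate (φ : ForecastingSystem) (u : ℕ → I) (n : ℕ) :
    initSeg (simulate φ u) n = simulateList φ u n := by
  induction n with
  | zero => rfl
  | succ n ih => rw [initSeg_succ, ih]; rfl

theorem simulate_mem_append (φ : ForecastingSystem) (u : ℕ → I) (x : List Bool) (y : Bool) :
    simulate φ u ∈ extensions (x ++ [y]) ↔
      simulate φ u ∈ extensions x ∧ u x.length ∈ {v : I | decide (v < φ x) = y} := by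
  rw [mem_extensions_append, and_congr_right_iff]
  intro h
  have h' : simulateList φ u x.length = x := by rw [← initSeg_simulate]; exact h
  simp [simulate, h']

theorem measurableSet_decide_lt (c : I) (y : Bool) : MeasurableSet {v : I | decide (v < c) = y} := by
  cases y
  · have : {v : I | decide (v < c) = false} = Set.Ici c := by ext v; simp
    rw [this]
    exact measurableSet_Ici
  · have : {v : I | decide (v < c) = true} = Set.Iio c := by ext v; simp
    rw [this]
    exact measurableSet_Iio

theorem exists_box (φ : ForecastingSystem) (x : List Bool) : ∃ t : ℕ → Set I,
    (∀ i, MeasurableSet (t i)) ∧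
      simulate φ ⁻¹' extensions x = Set.pi (Finset.range x.length) t := by
  induction x using List.reverseRecOn with
  | nil => exact ⟨fun _ => Set.univ, by simp, by simp [extensions_nil]⟩
  | append_singleton x y ih =>
    obtain ⟨t, ht, h⟩ := ih
    refine ⟨Function.update t x.length {v : I | decide (v < φ x) = y}, fun i => ?_, ?_⟩
    · rcases eq_or_ne i x.length with rfl | hi
      · simpa using measurableSet_decide_lt (φ x) y
      · simpa [hi] using ht i
    · ext u
      have hu : u ∈ simulate φ ⁻¹' extensions x ↔ u ∈ Set.pi (Finset.range x.length) t := by rw [h]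
      rw [Set.mem_preimage] at hu ⊢
      rw [simulate_mem_append, hu]
      simp only [Set.mem_pi, Finset.coe_range, Set.mem_Iio, List.length_append,
        List.length_singleton, Order.lt_add_one_iff]
      constructor
      · rintro ⟨h1, h2⟩ i hi
        rcases hi.eq_or_lt with rfl | hi
        · simpa using h2
        · simpa [hi.ne] using h1 i hi
      · intro h1
        refine ⟨fun i hi => ?_, by simpa using h1 x.length le_rfl⟩
        simpa [hi.ne] using h1 i hi.le

theorem measurable_simulate (φ : ForecastingSystem) : Measurable (simulate φ) := by
  refine Measurable.mono (mb := MeasurableSpace.generateFrom (Set.range extensions))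
    (measurable_generateFrom ?_) le_rfl generateFrom_extensions.le
  rintro _ ⟨x, rfl⟩
  obtain ⟨t, ht, h⟩ := exists_box φ x
  rw [h]
  exact MeasurableSet.pi (Finset.countable_toSet _) fun i _ => ht i

theorem exists_isForecastMeasure (φ : ForecastingSystem) :
    ∃ P : Measure Outcomes, IsForecastMeasure φ P := by
  refine ⟨(Measure.infinitePi fun _ : ℕ => (volume : Measure I)).map (simulate φ), ?_, ?_⟩
  · exact Measure.isProbabilityMeasure_map (measurable_simulate φ).aemeasurable
  · intro x
    rw [Measure.map_apply (measurable_simulate φ) (measurableSet_extensions _),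
      Measure.map_apply (measurable_simulate φ) (measurableSet_extensions _)]
    obtain ⟨t, ht, h⟩ := exists_box φ x
    have h' : simulate φ ⁻¹' extensions (x ++ [true]) =
        Set.pi (Finset.range (x.length + 1)) (Function.update t x.length (Set.Iio (φ x))) := by
      ext u
      have hu : u ∈ simulate φ ⁻¹' extensions x ↔ u ∈ Set.pi (Finset.range x.length) t := by rw [h]
      rw [Set.mem_preimage] at hu ⊢
      rw [simulate_mem_append, hu]
      simp only [Set.mem_pi, Finset.coe_range, Set.mem_Iio, Order.lt_add_one_iff]
      constructor
      · rintro ⟨h1, h2⟩ i hi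
        rcases hi.eq_or_lt with rfl | hi
        · simpa using h2
        · simpa [hi.ne] using h1 i hi
      · intro h1
        refine ⟨fun i hi => ?_, by simpa using h1 x.length le_rfl⟩
        simpa [hi.ne] using h1 i hi.le
    have hm : ∀ i, MeasurableSet (Function.update t x.length (Set.Iio (φ x)) i) := by
      intro i
      rcases eq_or_ne i x.length with rfl | hi
      · simp
      · simpa [hi] using ht i
    rw [h, h', Measure.infinitePi_pi _ (fun i _ => hm i), Measure.infinitePi_pi _ (fun i _ => ht i),
      Finset.prod_range_succ, mul_comm]
    congr 1
    · simp
    · refine Finset.prod_congr rfl fun i hi => ?_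
      rw [Function.update_of_ne (Finset.mem_range.1 hi).ne]

/-- Each forecasting system has exactly one measure with the defining property. -/
theorem existsUnique_isForecastMeasure (φ : ForecastingSystem) :
    ∃! P : Measure Outcomes, IsForecastMeasure φ P := by
  obtain ⟨P, hP⟩ := exists_isForecastMeasure φ
  exact ⟨P, hP, fun Q hQ => hQ.unique hP⟩

/-- The measure `P_φ` on outcome sequences generated by the forecasting system `φ`. -/
noncomputable def forecastMeasure (φ : ForecastingSystem) : Measure Outcomes :=
  (existsUnique_isForecastMeasure φ).choose

theorem isForecastMeasure_forecastMeasure (φ : ForecastingSystem) :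
    IsForecastMeasure φ (forecastMeasure φ) :=
  (existsUnique_isForecastMeasure φ).choose_spec.1

/-- The sequence `ω^φ` of forecast/outcome pairs: each outcome of `ω` is preceded by the forecast
that `φ` makes from the earlier outcomes. -/
def withForecasts (φ : ForecastingSystem) (ω : Outcomes) : PrequentialSpace :=
  fun n => (φ (initSeg ω n), ω n)

/-- The upper measure-theoretic probability of `E`: the supremum over all forecasting systems `φ` of
the `P_φ`-measure of `E^φ = {ω | ω^φ ∈ E}`. On a set that need not be measurable a
`Measure` is its outer measure, the infimum over the measurable sets that contain the set. -/
noncomputable def upperMeasureProb (E : Set PrequentialSpace) : ℝ≥0∞ :=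
  ⨆ φ : ForecastingSystem, forecastMeasure φ {ω | withForecasts φ ω ∈ E}

end Prequential

/-! The inequality `meas ≤ game` is Ville's inequality: along the forecasts of `φ` a
superfarthingale is a non-negative supermartingale under `P_φ`, so the probability that it exceeds
`c` is at most its initial value divided by `c`; then `c` tends to `1`.

The inequality `game ≤ meas` is a capacity argument. Upper game-theoretic probability is continuous
along increasing sequences of arbitrary sets (`upperGameProb_iUnion_of_monotone`), a consequence of
a game-theoretic Lévy zero-one law. As in Choquet's theorem, an analytic `E` with game probability
above `c` then contains a compact `K` all of whose open neighbourhoods have game probability above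
`c`.

On open sets the two probabilities agree: the conditional upper measure-theoretic probability is
itself a superfarthingale, by splicing forecasting systems, and it becomes `1` once the observed
prefix forces the sequence into the set. It remains to pass from neighbourhoods to `K` on the
measure side (`le_upperMeasureProb_of_forall_le`): forecasting systems form a compact space, and
simulating all `P_φ` from the same uniform variables makes the paths converge almost surely along a
convergent sequence of systems. -/

namespace Prequential

/-! ### Concatenation of finite and infinite sequences -/

/-- The infinite sequence that starts with the finite sequence `x` and continues with `s`. -/
def prepend {α : Type*} (x : List α) (s : ℕ → α) : ℕ → α :=
  fun n => x.getD n (s (n - x.length))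

theorem prepend_nil {α : Type*} (s : ℕ → α) : prepend [] s = s := by
  ext n; simp [prepend]

theorem prepend_append {α : Type*} (x y : List α) (s : ℕ → α) :
    prepend (x ++ y) s = prepend x (prepend y s) := by
  ext n
  rcases lt_or_ge n x.length with h | h
  · simp [prepend, h, List.getElem?_append_left]
  · simp [prepend, h, List.getElem?_append_right, Nat.sub_sub]

theorem prepend_initSeg_apply {α : Type*} (s t : ℕ → α) {i n : ℕ} (h : i < n) :
    prepend (initSeg s n) t i = s i := by
  simp [prepend, initSeg, h]

theorem prepend_initSeg_drop {α : Type*} (s : ℕ → α) (n : ℕ) :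
    prepend (initSeg s n) (fun k => s (k + n)) = s := by
  ext i
  rcases lt_or_ge i n with h | h
  · exact prepend_initSeg_apply s _ h
  · simp [prepend, initSeg, h]

theorem initSeg_prepend {α : Type*} (x : List α) (s : ℕ → α) (n : ℕ) :
    initSeg (prepend x s) (n + x.length) = x ++ initSeg s n := by
  induction n with
  | zero =>
    refine List.ext_getElem (by simp [initSeg]) fun i h _ => ?_
    simp [initSeg] at h
    simp [initSeg, prepend, h]
  | succ n ih =>
    rw [add_right_comm, initSeg_succ, ih, initSeg_succ, List.append_assoc]
    simp [prepend]

theorem initSeg_add {α : Type*} (s : ℕ → α) (n k : ℕ) :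
    initSeg s (k + n) = initSeg s n ++ initSeg (fun i => s (i + n)) k := by
  have h := initSeg_prepend (initSeg s n) (fun i => s (i + n)) k
  rwa [prepend_initSeg_drop, length_initSeg] at h

/-- The infinite sequences that lead into `E` when they follow `x`. -/
def tailSet {α : Type*} (E : Set (ℕ → α)) (x : List α) : Set (ℕ → α) :=
  {s | prepend x s ∈ E}

theorem tailSet_nil {α : Type*} (E : Set (ℕ → α)) : tailSet E [] = E := by
  ext s; simp [tailSet, prepend_nil]

theorem tailSet_append {α : Type*} (E : Set (ℕ → α)) (x y : List α) :
    tailSet E (x ++ y) = tailSet (tailSet E x) y := by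
  ext s; simp [tailSet, prepend_append]

theorem tailSet_mono {α : Type*} {E F : Set (ℕ → α)} (h : E ⊆ F) (x : List α) :
    tailSet E x ⊆ tailSet F x :=
  fun _ hs => h hs

theorem drop_mem_tailSet {α : Type*} {E : Set (ℕ → α)} {s : ℕ → α} (h : s ∈ E) (n : ℕ) :
    (fun k => s (k + n)) ∈ tailSet E (initSeg s n) := by
  simpa [tailSet, prepend_initSeg_drop] using h

/-! ### Superfarthingales -/

/-- The mean of a variable with values `a` at the outcome `0` and `b` at the outcome `1` when the
forecast is `p`. -/
noncomputable def mean (p : I) (a b : ℝ≥0∞) : ℝ≥0∞ :=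
  ENNReal.ofReal (1 - (p : ℝ)) * a + ENNReal.ofReal (p : ℝ) * b

theorem ofReal_add_ofReal_symm (p : I) :
    ENNReal.ofReal (1 - (p : ℝ)) + ENNReal.ofReal (p : ℝ) = 1 := by
  rw [← ENNReal.ofReal_add (by linarith [p.2.2]) p.2.1]; simp

theorem mean_self (p : I) (a : ℝ≥0∞) : mean p a a = a := by
  rw [mean, ← add_mul, ofReal_add_ofReal_symm, one_mul]

theorem mean_mono (p : I) {a b c d : ℝ≥0∞} (h : a ≤ c) (h' : b ≤ d) : mean p a b ≤ mean p c d := by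
  unfold mean; gcongr

theorem mean_add (p : I) (a b c d : ℝ≥0∞) :
    mean p (a + c) (b + d) = mean p a b + mean p c d := by
  unfold mean; ring

theorem mean_mul (p : I) (r a b : ℝ≥0∞) : mean p (r * a) (r * b) = r * mean p a b := by
  unfold mean; ring

theorem mean_tsum (p : I) (a b : ℕ → ℝ≥0∞) :
    mean p (∑' i, a i) (∑' i, b i) = ∑' i, mean p (a i) (b i) := by
  simp only [mean, ← ENNReal.tsum_mul_left, ENNReal.tsum_add]

theorem mean_iSup (p : I) {a b : ℕ → ℝ≥0∞} (ha : Monotone a) (hb : Monotone b) :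
    mean p (⨆ i, a i) (⨆ i, b i) = ⨆ i, mean p (a i) (b i) := by
  simp only [mean, ENNReal.mul_iSup]
  refine ENNReal.iSup_add_iSup_of_monotone ?_ ?_
  · intro i j h; have := ha h; dsimp only; gcongr
  · intro i j h; have := hb h; dsimp only; gcongr

/-- A superfarthingale: its value is at least its mean next value, for each forecast. -/
def IsSuperfarthingale (V : List (I × Bool) → ℝ≥0∞) : Prop :=
  ∀ (x : List (I × Bool)) (p : I), mean p (V (x ++ [(p, false)])) (V (x ++ [(p, true)])) ≤ V x

/-- `V` reaches `1` in the upper limit along each sequence in `E`. -/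
def Covers (V : List (I × Bool) → ℝ≥0∞) (E : Set PrequentialSpace) : Prop :=
  ∀ s ∈ E, 1 ≤ limsup (fun n => V (initSeg s n)) atTop

theorem Covers.mono {V W : List (I × Bool) → ℝ≥0∞} {E F : Set PrequentialSpace} (h : Covers V E)
    (hVW : ∀ x, V x ≤ W x) (hF : F ⊆ E) : Covers W F :=
  fun s hs => (h s (hF hs)).trans (limsup_le_limsup (Eventually.of_forall fun _ => hVW _))

theorem IsSuperfarthingale.shift {V : List (I × Bool) → ℝ≥0∞} (h : IsSuperfarthingale V)
    (x : List (I × Bool)) : IsSuperfarthingale fun y => V (x ++ y) := by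
  intro y p
  simpa only [List.append_assoc] using h (x ++ y) p

theorem Covers.shift {V : List (I × Bool) → ℝ≥0∞} {E : Set PrequentialSpace} (h : Covers V E)
    (x : List (I × Bool)) : Covers (fun y => V (x ++ y)) (tailSet E x) := by
  intro s hs
  have := h _ hs
  rw [← limsup_nat_add _ x.length] at this
  simpa only [initSeg_prepend] using this

/-- The step of the recursion for `dominating`: the state is the current finite sequence with the
current value. -/
noncomputable def dominatingStep (W : List (I × Bool) → ℝ≥0∞) (z : List (I × Bool) × ℝ≥0∞)
    (a : I × Bool) : List (I × Bool) × ℝ≥0∞ :=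
  (z.1 ++ [a],
    W (z.1 ++ [a]) + (z.2 - mean a.1 (W (z.1 ++ [(a.1, false)])) (W (z.1 ++ [(a.1, true)]))))

/-- A farthingale that dominates the superfarthingale `W` and starts with the same value. -/
noncomputable def dominating (W : List (I × Bool) → ℝ≥0∞) (x : List (I × Bool)) : ℝ≥0∞ :=
  (x.foldl (dominatingStep W) ([], W [])).2

theorem dominating_append (W : List (I × Bool) → ℝ≥0∞) (x : List (I × Bool)) (a : I × Bool) :
    dominating W (x ++ [a]) = W (x ++ [a]) +
      (dominating W x - mean a.1 (W (x ++ [(a.1, false)])) (W (x ++ [(a.1, true)]))) := by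
  have key : ∀ x : List (I × Bool), (x.foldl (dominatingStep W) ([], W [])).1 = x := by
    intro x
    induction x using List.reverseRecOn with
    | nil => rfl
    | append_singleton x y ih => rw [List.foldl_append]; simp [dominatingStep, ih]
  simp [dominating, List.foldl_append, dominatingStep, key]

theorem le_dominating (W : List (I × Bool) → ℝ≥0∞) (x : List (I × Bool)) :
    W x ≤ dominating W x := by
  induction x using List.reverseRecOn with
  | nil => rfl
  | append_singleton x y => rw [dominating_append]; exact le_self_add

/-- The slack, current value minus mean next value of `W`, is paid out equally on both outcomes, so
nothing is lost on average. Truncated subtraction is harmless because the mean never exceeds the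
current value, even when both are infinite. -/
theorem IsSuperfarthingale.isNonnegFarthingale_dominating {W : List (I × Bool) → ℝ≥0∞}
    (hW : IsSuperfarthingale W) : IsNonnegFarthingale (dominating W) := by
  intro x p
  change _ = mean p _ _
  rw [dominating_append, dominating_append, mean_add, mean_self, add_tsub_cancel_of_le]
  exact (hW x p).trans (le_dominating W x)

theorem upperGameProb_le {V : List (I × Bool) → ℝ≥0∞} {E : Set PrequentialSpace}
    (hV : IsSuperfarthingale V) (hE : Covers V E) : upperGameProb E ≤ V [] :=
  sInf_le ⟨dominating V, hV.isNonnegFarthingale_dominating, rfl,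
    hE.mono (le_dominating V) subset_rfl⟩

theorem exists_of_upperGameProb_lt {E : Set PrequentialSpace} {a : ℝ≥0∞}
    (h : upperGameProb E < a) :
    ∃ V, IsSuperfarthingale V ∧ Covers V E ∧ V [] < a := by
  obtain ⟨_, ⟨V, hV, rfl, hE⟩, hlt⟩ := sInf_lt_iff.1 h
  exact ⟨V, fun x p => (hV x p).ge, hE, hlt⟩

theorem le_upperGameProb {E : Set PrequentialSpace} {a : ℝ≥0∞}
    (h : ∀ V, IsSuperfarthingale V → Covers V E → a ≤ V []) : a ≤ upperGameProb E :=
  le_sInf fun _ ⟨V, hV, hVa, hE⟩ => hVa ▸ h V (fun x p => (hV x p).ge) hE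

theorem upperGameProb_mono {E F : Set PrequentialSpace} (h : E ⊆ F) :
    upperGameProb E ≤ upperGameProb F :=
  le_upperGameProb fun _ hV hF => upperGameProb_le hV (hF.mono (fun _ => le_rfl) h)

theorem isSuperfarthingale_const (a : ℝ≥0∞) : IsSuperfarthingale fun _ => a :=
  fun _ p => (mean_self p a).le

theorem upperGameProb_empty : upperGameProb ∅ = 0 :=
  le_zero_iff.1 (upperGameProb_le (isSuperfarthingale_const 0) (by simp [Covers]))

theorem upperGameProb_le_one (E : Set PrequentialSpace) : upperGameProb E ≤ 1 :=
  upperGameProb_le (isSuperfarthingale_const 1) (by simp [Covers])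

theorem upperGameProb_iUnion_le (E : ℕ → Set PrequentialSpace) :
    upperGameProb (⋃ i, E i) ≤ ∑' i, upperGameProb (E i) := by
  refine ENNReal.le_of_forall_pos_le_add fun ε hε hfin => ?_
  obtain ⟨δ, hδ, hsum⟩ := ENNReal.exists_pos_sum_of_countable (ε := ε) (by simpa using hε.ne') ℕ
  have key : ∀ i, ∃ V, IsSuperfarthingale V ∧ Covers V (E i) ∧
      V [] < upperGameProb (E i) + δ i := by
    intro i
    refine exists_of_upperGameProb_lt (ENNReal.lt_add_right ?_ (by simpa using (hδ i).ne'))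
    exact ((upperGameProb_le_one _).trans_lt ENNReal.one_lt_top).ne
  choose V hV hE hlt using key
  calc upperGameProb (⋃ i, E i) ≤ ∑' i, V i [] := by
        refine upperGameProb_le (V := fun x => ∑' i, V i x) (fun x p => ?_) fun s hs => ?_
        · rw [mean_tsum]
          exact ENNReal.tsum_le_tsum fun i => hV i x p
        · obtain ⟨i, hi⟩ := Set.mem_iUnion.1 hs
          exact (hE i).mono (fun x => ENNReal.le_tsum (f := fun i => V i x) i) subset_rfl s hi
    _ ≤ ∑' i, (upperGameProb (E i) + δ i) := ENNReal.tsum_le_tsum fun i => (hlt i).le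
    _ ≤ _ := by rw [ENNReal.tsum_add]; gcongr

theorem upperGameProb_union_le (E F : Set PrequentialSpace) :
    upperGameProb (E ∪ F) ≤ upperGameProb E + upperGameProb F := by
  have h := upperGameProb_iUnion_le fun n => if n = 0 then E else if n = 1 then F else ∅
  rw [tsum_eq_sum (s := {0, 1})] at h
  · refine (upperGameProb_mono ?_).trans (h.trans (by simp))
    rintro s (hs | hs)
    · exact Set.mem_iUnion.2 ⟨0, by simpa using hs⟩
    · exact Set.mem_iUnion.2 ⟨1, by simpa using hs⟩
  · intro n hn
    simp only [Finset.mem_insert, Finset.mem_singleton, not_or] at hn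
    simp [hn, upperGameProb_empty]

/-! ### Conditional upper game-theoretic probability -/

/-- The upper game-theoretic probability of `E` after the finite sequence `x`. -/
noncomputable def condGameProb (E : Set PrequentialSpace) (x : List (I × Bool)) : ℝ≥0∞ :=
  upperGameProb (tailSet E x)

theorem condGameProb_nil (E : Set PrequentialSpace) : condGameProb E [] = upperGameProb E := by
  rw [condGameProb, tailSet_nil]

theorem condGameProb_mono {E F : Set PrequentialSpace} (h : E ⊆ F) (x : List (I × Bool)) :
    condGameProb E x ≤ condGameProb F x :=
  upperGameProb_mono (tailSet_mono h x)

/-- Any superfarthingale that covers the tail of `E` after `x` also covers, once shifted, the tails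
after one more round. Hence its two next values bound the two conditional probabilities. -/
theorem isSuperfarthingale_condGameProb (E : Set PrequentialSpace) :
    IsSuperfarthingale (condGameProb E) := by
  intro x p
  refine le_upperGameProb fun V hV hE => ?_
  refine (mean_mono p ?_ ?_).trans (hV [] p) <;>
  · rw [condGameProb, tailSet_append]
    simpa using upperGameProb_le (hV.shift _) (hE.shift _)

/-- Follow the superfarthingale `A` until the first visit to `S`, at `z`, and `U z` afterwards. -/
noncomputable def glue (A : List (I × Bool) → ℝ≥0∞)
    (U : List (I × Bool) → List (I × Bool) → ℝ≥0∞) (S : Set (List (I × Bool)))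
    (x : List (I × Bool)) : ℝ≥0∞ :=
  open Classical in
  match x.inits.find? (fun z => z ∈ S) with
  | none => A x
  | some z => U z (x.drop z.length)

theorem inits_append_singleton {α : Type*} (x : List α) (a : α) :
    (x ++ [a]).inits = x.inits ++ [x ++ [a]] := by
  rw [List.inits_append]; simp

theorem glue_of_forall_notMem {A : List (I × Bool) → ℝ≥0∞}
    {U : List (I × Bool) → List (I × Bool) → ℝ≥0∞} {S : Set (List (I × Bool))}
    {x : List (I × Bool)} (h : ∀ z, z <+: x → z ∉ S) : glue A U S x = A x := by
  have : x.inits.find? (fun z => open Classical in decide (z ∈ S)) = none := by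
    simpa using h
  rw [glue, this]

theorem glue_append {A : List (I × Bool) → ℝ≥0∞}
    {U : List (I × Bool) → List (I × Bool) → ℝ≥0∞} {S : Set (List (I × Bool))}
    {z : List (I × Bool)} (hz : z ∈ S) (h : ∀ z', z' <+: z → z' ≠ z → z' ∉ S)
    (y : List (I × Bool)) : glue A U S (z ++ y) = U z y := by
  have : (z ++ y).inits.find? (fun z => open Classical in decide (z ∈ S)) = some z := by
    induction y using List.reverseRecOn with
    | nil =>
      rw [List.append_nil]
      rcases List.eq_nil_or_concat' z with rfl | ⟨w, a, rfl⟩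
      · simp [hz]
      · rw [inits_append_singleton, List.find?_append, List.find?_eq_none.2]
        · simp [hz]
        · intro w' hw'
          rw [List.mem_inits] at hw'
          simpa using h w' (hw'.trans (List.prefix_append _ _))
            (fun e => by have := hw'.length_le; simp [e] at this)
    | append_singleton y a ih =>
      rw [← List.append_assoc, inits_append_singleton, List.find?_append, ih]; rfl
  rw [glue, this]
  simp

theorem exists_first_prefix {α : Type*} {S : Set (List α)} {x w : List α} (hw : w <+: x)
    (hS : w ∈ S) : ∃ z y, x = z ++ y ∧ z ∈ S ∧ ∀ z', z' <+: z → z' ≠ z → z' ∉ S := by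
  induction hn : w.length using Nat.strong_induction_on generalizing w with
  | _ n ih =>
    by_cases h : ∀ z', z' <+: w → z' ≠ w → z' ∉ S
    · obtain ⟨y, rfl⟩ := hw
      exact ⟨w, y, rfl, hS, h⟩
    · push Not at h
      obtain ⟨z', hz', hne, hz'S⟩ := h
      refine ih z'.length ?_ (hz'.trans hw) hz'S rfl
      rw [← hn]
      exact lt_of_le_of_ne hz'.length_le fun e => hne (hz'.eq_of_length e)

/-- At the switch the value can only drop, from `A z` to `U z []`, and elsewhere one follows a
single superfarthingale. -/
theorem isSuperfarthingale_glue {A : List (I × Bool) → ℝ≥0∞}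
    {U : List (I × Bool) → List (I × Bool) → ℝ≥0∞} {S : Set (List (I × Bool))}
    (hA : IsSuperfarthingale A) (hU : ∀ z ∈ S, IsSuperfarthingale (U z))
    (hUA : ∀ z ∈ S, U z [] ≤ A z) : IsSuperfarthingale (glue A U S) := by
  intro x p
  by_cases h : ∀ z, z <+: x → z ∉ S
  · have key : ∀ a, glue A U S (x ++ [a]) ≤ A (x ++ [a]) := by
      intro a
      by_cases ha : x ++ [a] ∈ S
      · have := glue_append (A := A) (U := U) ha (fun z hz hne => ?_) []
        · rw [List.append_nil] at this
          exact this.trans_le (hUA _ ha)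
        · rw [List.prefix_concat_iff] at hz
          exact h z (hz.resolve_left hne)
      · refine (glue_of_forall_notMem fun z hz => ?_).le
        rcases List.prefix_concat_iff.1 hz with rfl | hz
        · exact ha
        · exact h z hz
    rw [glue_of_forall_notMem h]
    exact (mean_mono p (key _) (key _)).trans (hA x p)
  · push Not at h
    obtain ⟨w, hw, hwS⟩ := h
    obtain ⟨z, y, rfl, hz, hmin⟩ := exists_first_prefix hw hwS
    simp only [List.append_assoc, glue_append hz hmin]
    exact hU z hz y p

/-- Follow `A` up to `S`, where the capital suffices to buy a cover of the rest of `E`. The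
inequality at `S` is strict because the infimum defining `condGameProb` need not be attained. -/
theorem upperGameProb_le_of_condGameProb_lt {A : List (I × Bool) → ℝ≥0∞}
    {S : Set (List (I × Bool))} {E : Set PrequentialSpace} (hA : IsSuperfarthingale A)
    (hS : ∀ z ∈ S, condGameProb E z < A z) (hE : ∀ s ∈ E, ∃ n, initSeg s n ∈ S) :
    upperGameProb E ≤ A [] := by
  have : ∀ z, ∃ V, z ∈ S → IsSuperfarthingale V ∧ Covers V (tailSet E z) ∧ V [] < A z := by
    intro z
    by_cases hz : z ∈ S
    · obtain ⟨V, hV⟩ := exists_of_upperGameProb_lt (hS z hz)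
      exact ⟨V, fun _ => hV⟩
    · exact ⟨0, fun h => (hz h).elim⟩
  choose U hU using this
  have hsup := isSuperfarthingale_glue hA (fun z hz => (hU z hz).1) fun z hz => (hU z hz).2.2.le
  have hcov : Covers (glue A U S) E := by
    intro s hs
    obtain ⟨n, hn⟩ := hE s hs
    obtain ⟨z, y, hzy, hz, hmin⟩ := exists_first_prefix List.prefix_rfl hn
    have hzs : z = initSeg s z.length := by
      have hlen := congrArg List.length hzy
      rw [length_initSeg, List.length_append] at hlen
      rw [hlen, add_comm, initSeg_add] at hzy
      exact (List.append_inj hzy (length_initSeg _ _)).1.symm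
    have h1 := (hU z hz).2.1 (fun k => s (k + z.length)) (by
      have := drop_mem_tailSet hs z.length
      rwa [← hzs] at this)
    rw [← limsup_nat_add _ z.length]
    simpa only [initSeg_add, ← hzs, glue_append hz hmin] using h1
  refine (upperGameProb_le hsup hcov).trans ?_
  by_cases h : [] ∈ S
  · have := glue_append (A := A) (U := U) h (by simp) []
    rw [List.append_nil] at this
    exact this.trans_le (hU _ h).2.2.le
  · refine (glue_of_forall_notMem ?_).le
    simpa using h

/-! ### Lévy's zero-one law and continuity from below -/

theorem upperGameProb_iUnion_null {E : ℕ → Set PrequentialSpace}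
    (h : ∀ i, upperGameProb (E i) = 0) : upperGameProb (⋃ i, E i) = 0 :=
  le_zero_iff.1 ((upperGameProb_iUnion_le E).trans (by simp [h]))

/-- A contraction argument. After a long prefix that can still lead into the set `B`, a capital `b <
1` covers `E`, hence reaches any `c < 1` on `B`; stopping there and restarting a cover of `B` shows
that the worst conditional probability `r` of `B` satisfies `r ≤ r * b / c`. With `b < c` this
forces `r = 0`. -/
theorem upperGameProb_eventually_condGameProb_le (E : Set PrequentialSpace) (m : ℕ) {a : ℝ≥0∞}
    (ha : a < 1) :
    upperGameProb {s ∈ E | ∀ n ≥ m, condGameProb E (initSeg s n) ≤ a} = 0 := by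
  set B := {s ∈ E | ∀ n ≥ m, condGameProb E (initSeg s n) ≤ a} with hB
  set r := ⨆ (x : List (I × Bool)) (_ : m ≤ x.length), condGameProb B x with hr
  have hr1 : r ≤ 1 := iSup₂_le fun _ _ => upperGameProb_le_one _
  -- `b` bounds the initial capital and `c` is the stopping level; `c < 1` makes a limsup of at
  -- least `1` force a visit above `c`.
  obtain ⟨b, hab, hb1⟩ := exists_between ha
  obtain ⟨c, hbc, hc1⟩ := exists_between hb1
  have hb0 : b ≠ 0 := (pos_of_gt hab).ne'
  have hc0 : c ≠ 0 := (pos_of_gt hbc).ne'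
  have hct : c ≠ ∞ := (hc1.trans ENNReal.one_lt_top).ne
  have hbt : b ≠ ∞ := (hb1.trans ENNReal.one_lt_top).ne
  have key : ∀ x : List (I × Bool), m ≤ x.length → ∀ τ > r, condGameProb B x ≤ τ / c * b := by
    intro x hx τ hτ
    rcases (tailSet B x).eq_empty_or_nonempty with h | ⟨t, ht⟩
    · simp [condGameProb, h, upperGameProb_empty]
    · have hxa : condGameProb E x ≤ a := by
        have := ht.2 x.length hx
        have hi := initSeg_prepend x t 0
        rw [zero_add] at hi
        rwa [hi, show initSeg t 0 = [] from rfl, List.append_nil] at this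
      obtain ⟨V, hV, hVE, hVb⟩ := exists_of_upperGameProb_lt (hxa.trans_lt hab)
      refine (upperGameProb_le_of_condGameProb_lt (A := fun z => τ / c * V z)
        (S := {z | c ≤ V z}) ?_ ?_ ?_).trans ?_
      · intro y p
        rw [mean_mul]
        exact mul_le_mul' le_rfl (hV y p)
      · intro z hz
        have h1 : condGameProb (tailSet B x) z ≤ r := by
          rw [condGameProb, ← tailSet_append]
          exact le_iSup₂_of_le (x ++ z) (by simp; omega) le_rfl
        refine (h1.trans_lt hτ).trans_le ?_
        calc τ = τ / c * c := (ENNReal.div_mul_cancel hc0 hct).symm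
          _ ≤ τ / c * V z := by gcongr; exact hz
      · intro s hs
        have h1 := hVE s (tailSet_mono (Set.sep_subset _ _) x hs)
        obtain ⟨n, hn⟩ := (frequently_lt_of_lt_limsup (by isBoundedDefault)
          (hc1.trans_le h1)).exists
        exact ⟨n, hn.le⟩
      · gcongr
  have hr0 : r = 0 := by
    by_contra h0
    have hrt : r ≠ ∞ := (hr1.trans_lt ENNReal.one_lt_top).ne
    have hlt : r < r * c / b := by
      rw [ENNReal.lt_div_iff_mul_lt (Or.inl hb0) (Or.inl hbt)]
      exact ENNReal.mul_lt_mul_right h0 hrt hbc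
    obtain ⟨τ, hτ, hτ'⟩ := exists_between hlt
    rw [ENNReal.lt_div_iff_mul_lt (Or.inl hb0) (Or.inl hbt)] at hτ'
    have h1 : r ≤ τ / c * b := iSup₂_le fun x hx => key x hx τ hτ
    have h2 : τ / c * b < r := by
      rw [← ENNReal.mul_div_right_comm]
      exact ENNReal.div_lt_of_lt_mul hτ'
    exact absurd h1 h2.not_ge
  -- Hold a constant `δ > 0` for `m` rounds; by then `B` has conditional probability `r = 0 < δ`.
  refine le_zero_iff.1 (le_of_forall_gt fun ε hε => ?_)
  obtain ⟨δ, hδ, hδε⟩ := exists_between hε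
  refine (upperGameProb_le_of_condGameProb_lt (A := fun _ => δ) (S := {z | z.length = m})
    (isSuperfarthingale_const δ) ?_ fun s _ => ⟨m, length_initSeg s m⟩).trans_lt hδε
  intro z hz
  refine lt_of_le_of_lt ?_ hδ
  rw [← hr0]
  exact le_iSup₂_of_le z (show z.length = m from hz).ge le_rfl

/-- Lévy's zero-one law: along the sequences in `E`, the conditional upper probability of `E` has
upper limit `1`, outside a null set. -/
theorem upperGameProb_limsup_condGameProb_lt_one (E : Set PrequentialSpace) :
    upperGameProb {s ∈ E | limsup (fun n => condGameProb E (initSeg s n)) atTop < 1} = 0 := by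
  obtain ⟨u, -, hu, hlim⟩ := exists_seq_strictMono_tendsto' (zero_lt_one (α := ℝ≥0∞))
  refine le_zero_iff.1 ((upperGameProb_mono ?_).trans (upperGameProb_iUnion_null fun k =>
    upperGameProb_iUnion_null fun m =>
      upperGameProb_eventually_condGameProb_le E m (hu k).2).le)
  rintro s ⟨hs, hlt⟩
  obtain ⟨k, hk⟩ := (hlim.eventually_const_lt hlt).exists
  obtain ⟨m, hm⟩ := eventually_atTop.1 (eventually_lt_of_limsup_lt hk)
  exact Set.mem_iUnion₂.2 ⟨k, m, hs, fun n hn => (hm n hn).le⟩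

/-- The supremum over `i` of the conditional probabilities of `E i` is a superfarthingale, since
means commute with increasing suprema. By Lévy's law it covers the union outside a null set. -/
theorem upperGameProb_iUnion_of_monotone {E : ℕ → Set PrequentialSpace} (hE : Monotone E) :
    upperGameProb (⋃ i, E i) ≤ ⨆ i, upperGameProb (E i) := by
  set N : ℕ → Set PrequentialSpace := fun i =>
    {s ∈ E i | limsup (fun n => condGameProb (E i) (initSeg s n)) atTop < 1}
  set G : Set PrequentialSpace := (⋃ i, E i) \ ⋃ i, N i
  have hN : upperGameProb (⋃ i, N i) = 0 :=
    upperGameProb_iUnion_null fun i => upperGameProb_limsup_condGameProb_lt_one (E i)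
  have hG : upperGameProb G ≤ ⨆ i, condGameProb (E i) [] := by
    refine upperGameProb_le (V := fun x => ⨆ i, condGameProb (E i) x) (fun x p => ?_) ?_
    · rw [mean_iSup p (fun i j h => condGameProb_mono (hE h) _)
        (fun i j h => condGameProb_mono (hE h) _)]
      exact iSup_mono fun i => isSuperfarthingale_condGameProb (E i) x p
    · rintro s ⟨hs, hsN⟩
      obtain ⟨i, hi⟩ := Set.mem_iUnion.1 hs
      have h1 : 1 ≤ limsup (fun n => condGameProb (E i) (initSeg s n)) atTop := by
        by_contra h
        exact hsN (Set.mem_iUnion.2 ⟨i, hi, not_le.1 h⟩)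
      exact h1.trans (limsup_le_limsup (Eventually.of_forall fun n =>
        le_iSup (fun i => condGameProb (E i) (initSeg s n)) i))
  calc upperGameProb (⋃ i, E i) ≤ upperGameProb (G ∪ ⋃ i, N i) :=
        upperGameProb_mono (by rw [Set.sdiff_union_self]; exact Set.subset_union_left)
    _ ≤ upperGameProb G + upperGameProb (⋃ i, N i) := upperGameProb_union_le _ _
    _ ≤ ⨆ i, upperGameProb (E i) := by simpa only [hN, add_zero, condGameProb_nil] using hG

/-! ### Capacitability of analytic sets -/

/-- An analytic set contains a compact set `K` such that the open neighbourhoods of `K` are almost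
as large as the analytic set. -/
theorem exists_isCompact_forall_isOpen_lt_upperGameProb {E : Set PrequentialSpace}
    (hE : AnalyticSet E) {c : ℝ≥0∞} (hc : c < upperGameProb E) :
    ∃ K ⊆ E, IsCompact K ∧ ∀ U, IsOpen U → K ⊆ U → c < upperGameProb U := by
  rw [AnalyticSet] at hE
  rcases hE with rfl | ⟨f, hf, rfl⟩
  · simp [upperGameProb_empty] at hc
  -- A state is a list of bounds on the first terms of the argument of `f`.
  let A : List ℕ → Set PrequentialSpace := fun l => f '' {t | ∀ i (h : i < l.length), t i ≤ l[i]}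
  -- Relaxing the bound on the next coordinate exhausts `A l` increasingly, so by continuity from
  -- below some finite bound keeps the value above `c`.
  have step : ∀ l, c < upperGameProb (A l) → ∃ k, c < upperGameProb (A (l ++ [k])) := by
    intro l hl
    have hmono : Monotone fun k => A (l ++ [k]) := by
      intro j k hjk
      refine Set.image_mono fun t ht i hi => ?_
      have := ht i (by simpa using hi)
      rw [List.getElem_append] at this ⊢
      split_ifs at this ⊢ with h
      · exact this
      · simp only [List.getElem_singleton] at this ⊢; omega
    have hsub : A l ⊆ ⋃ k, A (l ++ [k]) := by
      rintro _ ⟨t, ht, rfl⟩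
      refine Set.mem_iUnion.2 ⟨t l.length, t, fun i hi => ?_, rfl⟩
      rw [List.getElem_append]
      split_ifs with h
      · exact ht i h
      · simp only [List.length_append, List.length_singleton] at hi
        obtain rfl : i = l.length := by omega
        simp
    exact lt_iSup_iff.1 (hl.trans_le
      ((upperGameProb_mono hsub).trans (upperGameProb_iUnion_of_monotone hmono)))
  choose! next hnext using step
  let L : ℕ → List ℕ := fun n => n.rec [] fun _ l => l ++ [next l]
  have hL : ∀ n, c < upperGameProb (A (L n)) := by
    intro n
    induction n with
    | zero => simpa [A, L] using hc
    | succ n ih => exact hnext _ ih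
  let b : ℕ → ℕ := fun n => next (L n)
  have hLb : ∀ n, L n = initSeg b n := by
    intro n
    induction n with
    | zero => rfl
    | succ n ih => rw [initSeg_succ, ← ih]
  have hA : ∀ n, A (L n) = f '' {t | ∀ i < n, t i ≤ b i} := by
    intro n
    simp [A, hLb, initSeg]
  have hcpt : IsCompact (Set.univ.pi fun i => Set.Iic (b i)) :=
    isCompact_univ_pi fun i => (Set.finite_Iic (b i)).isCompact
  refine ⟨f '' Set.univ.pi fun i => Set.Iic (b i), Set.image_subset_range _ _, hcpt.image hf,
    fun U hU hKU => ?_⟩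
  rw [Set.image_subset_iff] at hKU
  obtain ⟨n, hn⟩ : ∃ n, {t : ℕ → ℕ | ∀ i < n, t i ≤ b i} ⊆ f ⁻¹' U := by
    have hcyl : ∀ t ∈ Set.univ.pi fun i => Set.Iic (b i), ∃ n, PiNat.cylinder t n ⊆ f ⁻¹' U := by
      intro t ht
      obtain ⟨_, ⟨x, n, rfl⟩, htn, hsub⟩ := (PiNat.isTopologicalBasis_cylinders
        fun _ : ℕ => ℕ).exists_subset_of_mem_open (hKU ht) (hU.preimage hf)
      exact ⟨n, by rwa [PiNat.mem_cylinder_iff_eq.1 htn]⟩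
    choose! N hN using hcyl
    obtain ⟨F, hF, hcover⟩ := hcpt.elim_nhds_subcover (fun t => PiNat.cylinder t (N t))
      fun t _ => (PiNat.isOpen_cylinder _ t (N t)).mem_nhds (PiNat.self_mem_cylinder t (N t))
    refine ⟨F.sup N, fun t ht => ?_⟩
    -- Zero satisfies every bound, so truncating `t` gives a point of the compact box. The finitely
    -- many covering cylinders see only coordinates below `F.sup N`, so they cannot distinguish it
    -- from `t`.
    have hmem : (fun i => if i < F.sup N then t i else 0) ∈ Set.univ.pi fun i => Set.Iic (b i) := by
      intro i _
      by_cases h : i < F.sup N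
      · simpa [h] using ht i h
      · simp [h]
    obtain ⟨w, hw, hwt⟩ := Set.mem_iUnion₂.1 (hcover hmem)
    refine hN w (hF w hw) fun i hi => ?_
    have := hwt i hi
    simpa only [if_pos (hi.trans_le (Finset.le_sup (f := N) hw))] using this
  have := hL n
  rw [hA] at this
  exact this.trans_le (upperGameProb_mono (Set.image_subset_iff.2 hn))

/-! ### Conditioning a forecasting system on the first outcome -/

theorem measurable_prepend {α : Type*} [MeasurableSpace α] (x : List α) :
    Measurable (prepend x : (ℕ → α) → ℕ → α) := by
  refine measurable_pi_iff.2 fun n => ?_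
  rcases lt_or_ge n x.length with h | h
  · simp [prepend, h]
  · simpa [prepend, h] using measurable_pi_apply _

theorem preimage_prepend_extensions {α : Type*} [DecidableEq α] (a b : α) (x : List α) :
    prepend [a] ⁻¹' extensions (b :: x) = if a = b then extensions x else ∅ := by
  ext s
  have := initSeg_prepend [a] s x.length
  rw [List.length_singleton] at this
  simp only [Set.mem_preimage, extensions, Set.mem_ofPred_eq, List.length_cons, this]
  split_ifs with h <;> simp [h]

theorem withForecasts_prepend (φ : ForecastingSystem) (b : Bool) (ω : Outcomes) :
    withForecasts φ (prepend [b] ω) =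
      prepend [(φ [], b)] (withForecasts (fun x => φ (b :: x)) ω) := by
  ext1 n
  cases n with
  | zero => simp [withForecasts, prepend, initSeg]
  | succ n =>
    have := initSeg_prepend [b] ω n
    rw [List.length_singleton] at this
    simp only [withForecasts, this]
    simp [prepend, withForecasts]

theorem measurableSet_of_initSeg {D : Set Outcomes} {n : ℕ}
    (h : ∀ s t : Outcomes, initSeg s n = initSeg t n → s ∈ D → t ∈ D) : MeasurableSet D := by
  have : D = ⋃ x ∈ {x : List Bool | ∃ s ∈ D, initSeg s n = x}, extensions x := by
    ext t
    simp only [Set.mem_iUnion]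
    constructor
    · intro ht
      exact ⟨initSeg t n, ⟨t, ht, rfl⟩, by simp [extensions, length_initSeg]⟩
    · rintro ⟨_, ⟨s, hs, rfl⟩, ht⟩
      rw [extensions, Set.mem_ofPred_eq, length_initSeg] at ht
      exact h s t ht.symm hs
  rw [this]
  exact MeasurableSet.biUnion (Set.to_countable _) fun x _ => measurableSet_extensions x

theorem initSeg_withForecasts_congr (φ : ForecastingSystem) {s t : Outcomes} {n : ℕ}
    (h : initSeg s n = initSeg t n) :
    initSeg (withForecasts φ s) n = initSeg (withForecasts φ t) n := by
  rw [initSeg_eq_iff] at h ⊢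
  intro i hi
  have : initSeg s i = initSeg t i := (initSeg_eq_iff _ _ _).2 fun j hj => h j (hj.trans hi)
  simp [withForecasts, this, h i hi]

theorem measurable_withForecasts (φ : ForecastingSystem) : Measurable (withForecasts φ) := by
  refine measurable_pi_iff.2 fun n => fun B _ => measurableSet_of_initSeg (n := n + 1) ?_
  intro s t hst hs
  have := (initSeg_eq_iff _ _ _).1 (initSeg_withForecasts_congr φ hst) n n.lt_succ_self
  simpa [← this] using hs

instance (φ : ForecastingSystem) : IsProbabilityMeasure (forecastMeasure φ) :=
  (isForecastMeasure_forecastMeasure φ).1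

theorem IsForecastMeasure.eq_forecastMeasure {φ : ForecastingSystem} {P : Measure Outcomes}
    (h : IsForecastMeasure φ P) : forecastMeasure φ = P :=
  (isForecastMeasure_forecastMeasure φ).unique h

/-- By uniqueness it suffices that the mixture over the first outcome satisfies the defining
property of `P_φ`. -/
theorem forecastMeasure_eq_add (φ : ForecastingSystem) :
    forecastMeasure φ =
      ENNReal.ofReal (1 - (φ [] : ℝ)) •
          (forecastMeasure fun x => φ (false :: x)).map (prepend [false]) +
        ENNReal.ofReal (φ [] : ℝ) •
          (forecastMeasure fun x => φ (true :: x)).map (prepend [true]) := by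
  refine IsForecastMeasure.eq_forecastMeasure ⟨⟨?_⟩, fun x => ?_⟩
  · simp [Measure.map_apply (measurable_prepend _), ofReal_add_ofReal_symm]
  · simp only [Measure.add_apply, Measure.smul_apply, smul_eq_mul,
      Measure.map_apply (measurable_prepend _) (measurableSet_extensions _)]
    rcases x with _ | ⟨b, x⟩
    · simp [preimage_prepend_extensions, extensions_nil, ofReal_add_ofReal_symm]
    · have hf := (isForecastMeasure_forecastMeasure fun x => φ (false :: x)).2 x
      have ht := (isForecastMeasure_forecastMeasure fun x => φ (true :: x)).2 x
      cases b
      · simp [preimage_prepend_extensions, hf, mul_left_comm]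
      · simp [preimage_prepend_extensions, ht, mul_left_comm]

theorem forecastMeasure_apply (φ : ForecastingSystem) {D : Set Outcomes} (hD : MeasurableSet D) :
    forecastMeasure φ D = mean (φ [])
      (forecastMeasure (fun x => φ (false :: x)) {ω | prepend [false] ω ∈ D})
      (forecastMeasure (fun x => φ (true :: x)) {ω | prepend [true] ω ∈ D}) := by
  conv_lhs => rw [forecastMeasure_eq_add]
  simp only [Measure.add_apply, Measure.smul_apply, smul_eq_mul,
    Measure.map_apply (measurable_prepend _) hD]
  rfl

/-! ### Ville's inequality -/

/-- Induction on the horizon, conditioning on the first outcome. No measurability of `V` is needed: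
for fixed `φ` the event depends only on the first `N` outcomes. -/
theorem mul_forecastMeasure_exists_le {V : List (I × Bool) → ℝ≥0∞} (hV : IsSuperfarthingale V)
    (φ : ForecastingSystem) (c : ℝ≥0∞) (N : ℕ) :
    c * forecastMeasure φ {ω | ∃ n ≤ N, c < V (initSeg (withForecasts φ ω) n)} ≤ V [] := by
  induction N generalizing V φ with
  | zero =>
    by_cases h : c < V []
    · exact (mul_le_of_le_one_right' prob_le_one).trans h.le
    · simp [initSeg, h]
  | succ N ih =>
    by_cases h : c < V []
    · exact (mul_le_of_le_one_right' prob_le_one).trans h.le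
    · have key : ∀ b, c * forecastMeasure (fun x => φ (b :: x)) {ω | prepend [b] ω ∈
          {ω | ∃ n ≤ N + 1, c < V (initSeg (withForecasts φ ω) n)}} ≤ V [(φ [], b)] := by
        intro b
        refine le_trans ?_ (ih (hV.shift [(φ [], b)]) fun x => φ (b :: x))
        gcongr with ω
        rintro ⟨n, hn, hlt⟩
        rcases n with _ | n
        · exact absurd hlt h
        · refine ⟨n, by omega, ?_⟩
          rw [withForecasts_prepend] at hlt
          rwa [← initSeg_prepend [(φ [], b)]]
      rw [forecastMeasure_apply, ← mean_mul]
      · exact (mean_mono _ (key false) (key true)).trans (hV [] (φ []))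
      · refine measurableSet_of_initSeg (n := N + 1) ?_
        rintro s t hst ⟨n, hn, hlt⟩
        refine ⟨n, hn, ?_⟩
        rwa [← initSeg_withForecasts_congr φ (s := s)]
        rw [initSeg_eq_iff] at hst ⊢
        exact fun i hi => hst i (hi.trans_le hn)

theorem upperMeasureProb_le_upperGameProb (E : Set PrequentialSpace) :
    upperMeasureProb E ≤ upperGameProb E := by
  refine iSup_le fun φ => le_upperGameProb fun V hV hE => ?_
  have key : ∀ c < (1 : ℝ≥0∞), c * forecastMeasure φ {ω | withForecasts φ ω ∈ E} ≤ V [] := by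
    intro c hc
    have hmono : Monotone fun N : ℕ =>
        {ω | ∃ n ≤ N, c < V (initSeg (withForecasts φ ω) n)} :=
      fun i j hij ω ⟨n, hn, h⟩ => ⟨n, hn.trans hij, h⟩
    calc c * forecastMeasure φ {ω | withForecasts φ ω ∈ E}
        ≤ c * forecastMeasure φ
            (⋃ N : ℕ, {ω | ∃ n ≤ N, c < V (initSeg (withForecasts φ ω) n)}) := by
          gcongr with ω
          intro ω hω
          obtain ⟨n, hn⟩ := (frequently_lt_of_lt_limsup (by isBoundedDefault)
            (hc.trans_le (hE _ hω))).exists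
          exact Set.mem_iUnion.2 ⟨n, n, le_rfl, hn⟩
      _ ≤ V [] := by
          rw [hmono.measure_iUnion, ENNReal.mul_iSup]
          exact iSup_le fun N => mul_forecastMeasure_exists_le hV φ c N
  obtain ⟨u, -, hu, hlim⟩ := exists_seq_strictMono_tendsto' (zero_lt_one (α := ℝ≥0∞))
  have := ENNReal.Tendsto.mul_const (b := forecastMeasure φ {ω | withForecasts φ ω ∈ E}) hlim
    (Or.inl one_ne_zero)
  rw [one_mul] at this
  exact le_of_tendsto' this fun n => key _ (hu n).2

/-! ### Equality on open sets -/

theorem upperMeasureProb_mono {E F : Set PrequentialSpace} (h : E ⊆ F) :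
    upperMeasureProb E ≤ upperMeasureProb F :=
  iSup_mono fun _ => measure_mono fun _ hω => h hω

theorem upperMeasureProb_univ : upperMeasureProb Set.univ = 1 := by
  simp [upperMeasureProb]

/-- The forecasting system with first forecast `p` that goes on as `φ` or `ψ` when the first
outcome is `0` or `1`. -/
def splice (p : I) (φ ψ : ForecastingSystem) : ForecastingSystem
  | [] => p
  | false :: x => φ x
  | true :: x => ψ x

/-- Systems chosen separately for the two first outcomes combine by `splice` into one system with
first forecast `p`. -/
theorem mean_upperMeasureProb_le {E : Set PrequentialSpace} (hE : MeasurableSet E) (p : I) :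
    mean p (upperMeasureProb (tailSet E [(p, false)])) (upperMeasureProb (tailSet E [(p, true)])) ≤
      upperMeasureProb E := by
  simp only [mean, upperMeasureProb, ENNReal.mul_iSup]
  refine ENNReal.iSup_add_iSup_le fun φ ψ => ?_
  refine le_trans (le_of_eq ?_) (le_iSup _ (splice p φ ψ))
  have hm : MeasurableSet {ω | withForecasts (splice p φ ψ) ω ∈ E} :=
    measurable_withForecasts _ hE
  rw [forecastMeasure_apply _ hm]
  simp only [Set.mem_ofPred_eq, withForecasts_prepend]
  rfl

theorem isSuperfarthingale_upperMeasureProb {E : Set PrequentialSpace} (hE : MeasurableSet E) :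
    IsSuperfarthingale fun x => upperMeasureProb (tailSet E x) := by
  intro x p
  have hm : MeasurableSet (tailSet E x) := measurable_prepend x hE
  simpa only [tailSet_append] using mean_upperMeasureProb_le hm p

theorem exists_tailSet_initSeg_eq_univ {α : Type*} [TopologicalSpace α] {U : Set (ℕ → α)}
    (hU : IsOpen U) {s : ℕ → α} (hs : s ∈ U) :
    ∃ n, ∀ k ≥ n, tailSet U (initSeg s k) = Set.univ := by
  obtain ⟨F, u, hu, hsub⟩ := isOpen_pi_iff.1 hU s hs
  -- A basic neighbourhood of `s` in `U` constrains only the coordinates in `F`; the `+ 1` fixes the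
  -- largest of them too.
  refine ⟨F.sup id + 1, fun k hk => Set.eq_univ_of_forall fun t => hsub fun i hi => ?_⟩
  have : i ≤ F.sup id := Finset.le_sup (f := id) hi
  rw [prepend_initSeg_apply s t (show i < k by omega)]
  exact (hu i hi).2

theorem upperGameProb_le_upperMeasureProb_of_isOpen {U : Set PrequentialSpace} (hU : IsOpen U) :
    upperGameProb U ≤ upperMeasureProb U := by
  have := upperGameProb_le (isSuperfarthingale_upperMeasureProb hU.measurableSet) (E := U) ?_
  · simpa only [tailSet_nil] using this
  · intro s hs
    obtain ⟨n, hn⟩ := exists_tailSet_initSeg_eq_univ hU hs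
    refine le_limsup_of_frequently_le (Eventually.frequently ?_) (by isBoundedDefault)
    filter_upwards [eventually_ge_atTop n] with k hk
    rw [hn k hk, upperMeasureProb_univ]

/-! ### Continuity along neighbourhoods of a compact set -/

/-- The law of independent uniform variables, which drive the simulation of the outcomes. -/
noncomputable def uniformLaw : Measure (ℕ → I) :=
  Measure.infinitePi fun _ : ℕ => (volume : Measure I)

instance : IsProbabilityMeasure uniformLaw := by
  unfold uniformLaw; infer_instance

/-- This couples all the measures `P_φ` on one probability space, independent of `φ`. -/
theorem forecastMeasure_eq_map_simulate (φ : ForecastingSystem) :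
    forecastMeasure φ = uniformLaw.map (simulate φ) := by
  refine IsForecastMeasure.eq_forecastMeasure ⟨?_, fun x => ?_⟩
  · exact Measure.isProbabilityMeasure_map (measurable_simulate φ).aemeasurable
  · obtain ⟨t, ht, h⟩ := exists_box φ x
    have h' : simulate φ ⁻¹' extensions (x ++ [true]) =
        Set.pi (Finset.range (x.length + 1)) (Function.update t x.length (Set.Iio (φ x))) := by
      ext u
      have hu : simulate φ u ∈ extensions x ↔ u ∈ Set.pi (Finset.range x.length) t := by
        rw [← h]; rfl
      rw [Set.mem_preimage, simulate_mem_append, hu, Finset.range_add_one, Finset.coe_insert,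
        Set.insert_pi, and_comm]
      refine and_congr (by simp) (forall₂_congr fun i hi => ?_)
      rw [Function.update_of_ne (Finset.mem_range.1 hi).ne]
    have hm : ∀ i, MeasurableSet (Function.update t x.length (Set.Iio (φ x)) i) := by
      intro i
      rcases eq_or_ne i x.length with rfl | hi
      · simp
      · simpa [hi] using ht i
    rw [Measure.map_apply (measurable_simulate φ) (measurableSet_extensions _),
      Measure.map_apply (measurable_simulate φ) (measurableSet_extensions _), h, h', uniformLaw,
      Measure.infinitePi_pi _ (fun i _ => hm i), Measure.infinitePi_pi _ (fun i _ => ht i),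
      Finset.prod_range_succ, mul_comm]
    congr 1
    · simp
    · refine Finset.prod_congr rfl fun i hi => ?_
      rw [Function.update_of_ne (Finset.mem_range.1 hi).ne]

/-- Only countably many ties are possible, each null. Ties are where `decide (u n < φ x)` can jump
as `φ` varies. -/
theorem ae_forall_apply_ne (φ : ForecastingSystem) :
    ∀ᵐ u ∂uniformLaw, ∀ n x, u n ≠ φ x := by
  rw [ae_all_iff]
  intro n
  rw [ae_all_iff]
  intro x
  have h := (measurePreserving_eval_infinitePi (fun _ : ℕ => (volume : Measure I)) n)
  have h0 : (volume : Measure I) {φ x} = 0 := measure_singleton _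
  rw [← h.measure_preimage (measurableSet_singleton _).nullMeasurableSet] at h0
  exact measure_eq_zero_iff_ae_notMem.1 h0

/-- Without ties, each finite block of simulated outcomes is eventually constant in `k`, and the
forecasts made from it converge pointwise. -/
theorem tendsto_withForecasts_simulate {ψ : ℕ → ForecastingSystem} {φ : ForecastingSystem}
    (hψ : Tendsto ψ atTop (nhds φ)) {u : ℕ → I} (hu : ∀ n x, u n ≠ φ x) :
    Tendsto (fun k => withForecasts (ψ k) (simulate (ψ k) u)) atTop
      (nhds (withForecasts φ (simulate φ u))) := by
  rw [tendsto_pi_nhds] at hψ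
  have hdec : ∀ n x, ∀ᶠ k in atTop, decide (u n < ψ k x) = decide (u n < φ x) := by
    intro n x
    rcases (hu n x).lt_or_gt with h | h
    · filter_upwards [(hψ x).eventually_const_lt h] with k hk
      simp [hk, h]
    · filter_upwards [(hψ x).eventually_lt_const h] with k hk
      rw [decide_eq_false hk.not_gt, decide_eq_false h.not_gt]
  have hlist : ∀ n, ∀ᶠ k in atTop, simulateList (ψ k) u n = simulateList φ u n := by
    intro n
    induction n with
    | zero => simp [simulateList]
    | succ n ih =>
      filter_upwards [ih, hdec n (simulateList φ u n)] with k hk hk'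
      simp only [simulateList, hk, hk']
  refine tendsto_pi_nhds.2 fun n => Tendsto.prodMk_nhds ?_ ?_
  · simp only [initSeg_simulate]
    refine (hψ (simulateList φ u n)).congr' ?_
    filter_upwards [hlist n] with k hk
    rw [hk]
  · refine tendsto_const_nhds.congr' ?_
    filter_upwards [hlist n, hdec n (simulateList φ u n)] with k hk hk'
    simp only [simulate, hk, hk']

/-- Take nearly optimal systems for the `U n` and a limit `φ` of a subsequence. A path that lies in
infinitely many of the sets has its limit in every `closure (U m)`; the hypothesis concerns closures
for this reason. -/
theorem le_upperMeasureProb_of_forall_le {U : ℕ → Set PrequentialSpace} {K : Set PrequentialSpace}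
    (hU : ∀ n, IsOpen (U n)) (hmono : Antitone U) (hK : ⋂ n, closure (U n) ⊆ K)
    {c : ℝ≥0∞} (hc : ∀ n, c ≤ upperMeasureProb (U n)) : c ≤ upperMeasureProb K := by
  refine le_of_forall_lt fun a ha => ?_
  obtain ⟨b, hab, hbc⟩ := exists_between ha
  have : ∀ n, ∃ φ, b < forecastMeasure φ {ω | withForecasts φ ω ∈ U n} :=
    fun n => lt_iSup_iff.1 (hbc.trans_le (hc n))
  choose ψ hψ using this
  -- A forecasting system is a point of a countable power of `[0,1]`, which is sequentially compact.
  obtain ⟨φ, g, hg, hlim⟩ := SeqCompactSpace.tendsto_subseq ψ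
  refine hab.trans_le (le_iSup_of_le φ ?_)
  set A : ℕ → Set (ℕ → I) := fun n =>
    {u | withForecasts (ψ (g n)) (simulate (ψ (g n)) u) ∈ U (g n)}
  have hA : ∀ n, MeasurableSet (A n) := fun n =>
    measurable_simulate _ (measurable_withForecasts _ (hU _).measurableSet)
  have hbA : ∀ n, b ≤ uniformLaw (A n) := by
    intro n
    have hm : MeasurableSet {ω | withForecasts (ψ (g n)) ω ∈ U (g n)} :=
      measurable_withForecasts _ (hU _).measurableSet
    have := hψ (g n)
    rw [forecastMeasure_eq_map_simulate, Measure.map_apply (measurable_simulate _) hm] at this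
    exact this.le
  have hanti : Antitone fun n => ⋃ i ≥ n, A i :=
    fun m n h => Set.biUnion_mono (fun i hi => h.trans hi) fun _ _ => subset_rfl
  have hclosed : IsClosed (⋂ n, closure (U n)) := isClosed_iInter fun _ => isClosed_closure
  -- Reverse Fatou: events of probability at least `b` have a limit superior of probability at least
  -- `b`.
  calc b ≤ uniformLaw (⋂ n, ⋃ i ≥ n, A i) := by
        rw [hanti.measure_iInter (fun n => (MeasurableSet.biUnion (Set.to_countable _)
          fun i _ => hA i).nullMeasurableSet) ⟨0, measure_ne_top _ _⟩]
        exact le_iInf fun n => (hbA n).trans 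
          (measure_mono (Set.subset_biUnion_of_mem (u := A) (Set.mem_Ici.2 le_rfl)))
    _ ≤ uniformLaw (simulate φ ⁻¹' (withForecasts φ ⁻¹' ⋂ n, closure (U n))) := by
        refine measure_mono_ae ?_
        filter_upwards [ae_forall_apply_ne φ] with u hu hmem
        refine Set.mem_iInter.2 fun m => ?_
        refine isClosed_closure.mem_of_frequently_of_tendsto ?_
          (tendsto_withForecasts_simulate hlim hu)
        rw [frequently_atTop]
        intro n
        obtain ⟨i, hi, hiA⟩ := Set.mem_iUnion₂.1 (Set.mem_iInter.1 hmem (max m n))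
        exact ⟨i, (le_max_right _ _).trans hi, subset_closure
          (hmono (((le_max_left _ _).trans hi).trans (hg.id_le i)) hiA)⟩
    _ = forecastMeasure φ (withForecasts φ ⁻¹' ⋂ n, closure (U n)) := by
        rw [forecastMeasure_eq_map_simulate, Measure.map_apply (measurable_simulate _)
          (measurable_withForecasts _ hclosed.measurableSet)]
    _ ≤ forecastMeasure φ {ω | withForecasts φ ω ∈ K} := measure_mono fun _ h => hK h

theorem exists_isOpen_antitone_iInter_closure_subset {X : Type*} [TopologicalSpace X]
    [TopologicalSpace.MetrizableSpace X] {K : Set X} (hK : IsClosed K) :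
    ∃ U : ℕ → Set X, (∀ n, IsOpen (U n)) ∧ Antitone U ∧ (∀ n, K ⊆ U n) ∧
      ⋂ n, closure (U n) ⊆ K := by
  let _ := TopologicalSpace.metrizableSpaceMetric X
  obtain ⟨δ, hanti, hpos, hlim⟩ := exists_seq_strictAnti_tendsto (0 : ℝ)
  refine ⟨fun n => Metric.thickening (δ n) K, fun n => Metric.isOpen_thickening,
    fun m n h => Metric.thickening_mono (hanti.antitone h) K,
    fun n => Metric.self_subset_thickening (hpos n) K, ?_⟩
  conv_rhs => rw [← hK.closure_eq, Metric.closure_eq_iInter_cthickening]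
  refine Set.subset_iInter₂ fun ε hε => ?_
  obtain ⟨n, hn⟩ := (hlim.eventually_lt_const hε).exists
  exact (Set.iInter_subset _ n).trans ((Metric.closure_thickening_subset_cthickening _ _).trans
    (Metric.cthickening_mono hn.le K))

end Prequential

theorem theorem1 (E : Set Prequential.PrequentialSpace) (hE : MeasureTheory.AnalyticSet E) :
    Prequential.upperGameProb E = Prequential.upperMeasureProb E := by
  refine le_antisymm (le_of_forall_lt_imp_le_of_dense fun c hc => ?_)
    (Prequential.upperMeasureProb_le_upperGameProb E)
  obtain ⟨K, hKE, hK, hKU⟩ :=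
    Prequential.exists_isCompact_forall_isOpen_lt_upperGameProb hE hc
  obtain ⟨U, hU, hanti, hKsub, hinter⟩ :=
    Prequential.exists_isOpen_antitone_iInter_closure_subset hK.isClosed
  refine (Prequential.le_upperMeasureProb_of_forall_le hU hanti hinter fun n => ?_).trans
    (Prequential.upperMeasureProb_mono hKE)
  exact (hKU _ (hU n) (hKsub n)).le.trans
    (Prequential.upperGameProb_le_upperMeasureProb_of_isOpen (hU n))
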